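/- Let $N\ge 0$ and $T\ge 1$ be integers, let $D$ be a probability distribution on $\mathbb{R}^N\times\{-1,+1\}$, and let $S=((x_1,y_1),\ldots,(x_T,y_T))$ be drawn i.i.d. according to $D$. Let $\operatorname{sgn}(z)=1$ for $z>0$ and $\operatorname{sgn}(z)=-1$ for $z<0$, and let $\operatorname{sgn}(0)\in\{-1,0,1\}$ be any fixed convention. The Perceptron algorithm starts with $w_1=0$ and, for $t=1,\ldots,T$, predicts $\operatorname{sgn}(w_t\cdot x_t)$; if $\operatorname{sgn}(w_t\cdot x_t)\neq y_t$ it makes an update $w_{t+1}=w_t+y_tx_t$, and otherwise $w_{t+1}=w_t$. Let $I\subseteq\{1,\ldots,T\}$ be the set of rounds at which an update is made. For $\rho>0$ and $u\in\mathbb{R}^N$ with $\|u\|\le 1$, let $L_\rho(u)=\big[(1-\tfrac{y_t(u\cdot x_t)}{\rho})_+\big]_{t\in I}$ be the vector of $\rho$-hinge losses of $u$ on the update rounds. For $\delta>0$, let $\hat w=w_{i^*}$ be the weight vector of the penalized risk minimizing hypothesis for the zero-one loss, that is, $$i^*\in\operatorname*{argmin}_{i\in\{1,\ldots,T\}}\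 \frac{1}{T-i+1}\sum_{t=i}^{T}\mathbf 1_{\operatorname{sgn}(w_i\cdot x_t)\neq y_t}+\sqrt{\frac{\log\frac{T(T+1)}{\delta}}{2(T-i+1)}}\,,$$ with ties broken arbitrarily. Then, for any $\delta>0$, with probability at least $1-\delta$ over the draw of $S$, $$\Pr_{(x,y)\sim D}\big[y(\hat w\cdot x)<0\big]\ \le\ \inf_{\rho>0,\ \|u\|\le 1}\frac1T\left(\frac{\|L_\rho(u)\|_2}{2}+\sqrt{\frac{\|L_\rho(u)\|_2^2}{4}+\frac{\sqrt{\sum_{t\in I}\|x_t\|^2}}{\rho}}\right)^2+6\sqrt{\frac1T\log\frac{2(T+1)}{\delta}}\,.$$ -/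

import Mathlib

namespace Perceptron

noncomputable section

/-- A labeled example `(x, y)`: an instance `x ∈ ℝ^N` with its Euclidean norm, and a real label
`y`. (That labels are `±1` is a hypothesis on the distribution.) -/
abbrev Example (N : ℕ) : Type := EuclideanSpace ℝ (Fin N) × ℝ

/-- The sign function with the convention `sgn 0 = σ`, where `σ ∈ {-1, 0, 1}`. -/
def sgn (σ : SignType) (z : ℝ) : ℝ :=
  if 0 < z then 1 else if z < 0 then -1 else (σ : ℝ)

/-- The prediction `sgn (w · x)` of the linear classifier with weight vector `w`. -/
def predict {N : ℕ} (σ : SignType) (w x : EuclideanSpace ℝ (Fin N)) : ℝ :=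
  sgn σ (inner ℝ w x)

/-- One round of the Perceptron algorithm: starting from the weight vector `w`, process the
example `z = (x, y)`; if the prediction differs from `y`, move to `w + y x`. -/
def step {N : ℕ} (σ : SignType) (w : EuclideanSpace ℝ (Fin N)) (z : Example N) :
    EuclideanSpace ℝ (Fin N) :=
  if predict σ w z.1 ≠ z.2 then w + z.2 • z.1 else w

/-- The weight vectors generated by the Perceptron algorithm on the sample `S`, started at `0`:
`weights σ S k` is the weight vector after the first `k` examples have been processed. -/
def weights {N T : ℕ} (σ : SignType) (S : Fin T → Example N) :
    Fin (T + 1) → EuclideanSpace ℝ (Fin N) :=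
  Fin.induction (motive := fun _ => EuclideanSpace ℝ (Fin N)) 0 (fun t w => step σ w (S t))

/-- The weight vector with which the Perceptron algorithm enters round `t`. Rounds are numbered
`0, …, T - 1`. -/
def weightAt {N T : ℕ} (σ : SignType) (S : Fin T → Example N) (t : Fin T) :
    EuclideanSpace ℝ (Fin N) :=
  weights σ S t.castSucc

/-- The set `I` of rounds at which the Perceptron algorithm makes an update. -/
def updateRounds {N T : ℕ} (σ : SignType) (S : Fin T → Example N) : Finset (Fin T) :=
  Finset.univ.filter fun t => predict σ (weightAt σ S t) (S t).1 ≠ (S t).2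

/-- The vector `[(1 - y_t (u · x_t) / ρ)_+]_{t ∈ I}` of `ρ`-hinge losses of `u`, as an element of
the Euclidean space `ℝ^I`. -/
def hingeLosses {N T : ℕ} (S : Fin T → Example N) (I : Finset (Fin T)) (ρ : ℝ)
    (u : EuclideanSpace ℝ (Fin N)) : EuclideanSpace ℝ {t : Fin T // t ∈ I} :=
  WithLp.toLp 2 fun t => max (1 - (S t).2 * inner ℝ u (S t).1 / ρ) 0

/-- The zero-one loss, as a function of `y h(x)`. -/
def zeroOneLoss (z : ℝ) : ℝ := if z ≤ 0 then 1 else 0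

/-- The penalized empirical risk of the `i`-th of the hypotheses `h_0, …, h_{T-1}`: the average
loss of `h_i` on the `T - i` examples numbered `i, …, T - 1`, plus the penalty
`√(log (T (T + 1) / δ) / (2 (T - i)))`. -/
def penalizedRisk {N T : ℕ} (L : ℝ → ℝ) (δ : ℝ) (S : Fin T → Example N)
    (h : Fin T → EuclideanSpace ℝ (Fin N) → ℝ) (i : Fin T) : ℝ :=
  1 / ((T : ℝ) - (i : ℕ)) * ∑ t ∈ Finset.Ici i, L ((S t).2 * h i (S t).1)
    + √(Real.log ((T : ℝ) * (T + 1) / δ) / (2 * ((T : ℝ) - (i : ℕ))))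

/-- `i` is a minimizer of the penalized empirical risk, for the zero-one loss, among the hypotheses
`x ↦ sgn (w_i · x)` generated by the Perceptron algorithm on `S`. -/
def IsPenalizedRiskMinimizer {N T : ℕ} (σ : SignType) (δ : ℝ) (S : Fin T → Example N)
    (i : Fin T) : Prop :=
  ∀ j : Fin T,
    penalizedRisk zeroOneLoss δ S (fun k => predict σ (weightAt σ S k)) i ≤
      penalizedRisk zeroOneLoss δ S (fun k => predict σ (weightAt σ S k)) j

end

end Perceptron

open MeasureTheory ProbabilityTheory

namespace Perceptron

/-! The proof is online-to-batch conversion followed by a mistake bound. Write `R_j` for the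
zero-one risk of the hypothesis entering round `j`, `c_j` for its penalty and `M` for the number of
updates.

That hypothesis depends only on earlier examples, so Azuma–Hoeffding for predictable losses
(`measureReal_predictable_deviation_le`) applies twice. On the diagonal it gives `∑ R_j < M + √(T/2
· log (2/δ))`. On the tails it puts each penalized empirical mean within `c_j` of `R_j`, so a
minimizer `i` satisfies `R_i ≤ R_j + 2 c_j` for every `j` (`integral_roundLoss_minimizer_le`).
Averaging over `j` bounds `R_i` by `M / T` plus a deviation term, which `sum_penalty_le` and
`penalty_add_deviation_le` control.

Finally `card_updateRounds_le` bounds `M` deterministically: on an update round `1 ≤ l_t + y_t (u ·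
x_t) / ρ`, where `l_t` is the hinge loss. Cauchy–Schwarz handles the losses, the final weight vector
handles the margins, and the result is a quadratic inequality in `√M`. -/

/-! ### Exponential moments and Azuma–Hoeffding -/

/-- Hoeffding's lemma, in `∫⁻` form so that the induction below needs only measurability for
Tonelli. -/
theorem lintegral_exp_centered_le {Z : Type*} [MeasurableSpace Z] (D : Measure Z)
    [IsProbabilityMeasure D] (a : ℝ) (f : Z → ℝ) (hm : Measurable f)
    (h01 : ∀ z, f z ∈ Set.Icc (0 : ℝ) 1) :
    ∫⁻ z, ENNReal.ofReal (Real.exp (a * (∫ z', f z' ∂D - f z))) ∂D ≤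
      ENNReal.ofReal (Real.exp (a ^ 2 / 8)) := by
  have h := hasSubgaussianMGF_of_mem_Icc (μ := D) hm.aemeasurable (ae_of_all _ h01)
  have hi := h.integrable_exp_mul (-a)
  have hb := h.mgf_le (-a)
  have e : ∀ z, Real.exp (-a * (f z - ∫ z', f z' ∂D)) =
      Real.exp (a * (∫ z', f z' ∂D - f z)) := fun z => by congr 1; ring
  simp only [mgf, e] at hb hi
  rw [← ofReal_integral_eq_lintegral_ofReal hi (ae_of_all _ fun z => (Real.exp_pos _).le)]
  refine ENNReal.ofReal_le_ofReal (hb.trans (Real.exp_le_exp.2 ?_))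
  simp
  apply le_of_eq; ring

/-- Exponential moment bound for the weighted deviations of a predictable sequence of `[0, 1]`-valued
functions of i.i.d. examples. -/
theorem lintegral_exp_predictable_le {Z : Type*} [MeasurableSpace Z] (D : Measure Z)
    [IsProbabilityMeasure D] : ∀ (T : ℕ) (a : Fin T → ℝ) (g : Fin T → (Fin T → Z) → Z → ℝ),
    (∀ t, Measurable (Function.uncurry (g t))) → (∀ t S z, g t S z ∈ Set.Icc (0 : ℝ) 1) →
    (∀ t S S', (∀ s < t, S s = S' s) → g t S = g t S') →
    ∫⁻ S, ENNReal.ofReal (Real.exp (∑ t, a t * (∫ z, g t S z ∂D - g t S (S t))))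
      ∂(Measure.pi fun _ => D) ≤ ENNReal.ofReal (Real.exp (∑ t, a t ^ 2 / 8)) := by
  intro T
  induction T with
  | zero => intro a g _ _ _; simp
  | succ T ih =>
    intro a g hm h01 hp
    obtain ⟨z₀⟩ : Nonempty Z := D.nonempty_of_neZero
    have hint : ∀ t, Measurable fun S => ∫ z, g t S z ∂D := fun t =>
      ((hm t).stronglyMeasurable.integral_prod_right).measurable
    have hdiag : ∀ t, Measurable fun S => g t S (S t) := fun t =>
      (hm t).comp (measurable_id.prodMk (measurable_pi_apply t))
    have hF : Measurable fun S : Fin (T + 1) → Z => ENNReal.ofReal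
        (Real.exp (∑ t, a t * (∫ z, g t S z ∂D - g t S (S t)))) :=
      (Real.measurable_exp.comp (Finset.measurable_sum _ fun t _ =>
        ((hint t).sub (hdiag t)).const_mul _)).ennreal_ofReal
    have hmp := (measurePreserving_piFinSuccAbove (fun _ : Fin (T + 1) => D) 0).symm
    rw [← hmp.lintegral_comp hF]
    refine (lintegral_prod _ (hF.comp hmp.measurable).aemeasurable).trans_le ?_
    have hcons : ∀ z S, (MeasurableEquiv.piFinSuccAbove (fun _ : Fin (T + 1) => Z) 0).symm (z, S)
        = Fin.cons z S := fun z S => by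
      simp [MeasurableEquiv.piFinSuccAbove]
      rfl
    simp only [Function.comp_apply, hcons]
    -- By predictability the first function ignores the sample, so `z₀` is arbitrary. With the first
    -- example frozen, the remaining functions are again predictable, and the induction hypothesis
    -- bounds them uniformly in that example.
    set f := g 0 (fun _ => z₀)
    have hf : ∀ S, g 0 S = f := fun S => hp 0 _ _ fun s hs => absurd hs (Fin.not_lt_zero s)
    have hstep : ∀ z, ∫⁻ S, ENNReal.ofReal (Real.exp (∑ t, a t *
          (∫ z', g t (Fin.cons z S : Fin (T + 1) → Z) z' ∂D
            - g t (Fin.cons z S : Fin (T + 1) → Z) ((Fin.cons z S : Fin (T + 1) → Z) t))))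
          ∂(Measure.pi fun _ => D) ≤
        ENNReal.ofReal (Real.exp (a 0 * (∫ z', f z' ∂D - f z))) *
          ENNReal.ofReal (Real.exp (∑ t : Fin T, a t.succ ^ 2 / 8)) := by
      intro z
      have hc : Measurable fun S : Fin T → Z => (Fin.cons z S : Fin (T + 1) → Z) := by
        refine measurable_pi_iff.2 fun t => ?_
        refine Fin.cases ?_ (fun t => ?_) t
        · simp
        · simpa using measurable_pi_apply t
      simp only [Fin.sum_univ_succ, hf, Fin.cons_zero, Fin.cons_succ, Real.exp_add,
        ENNReal.ofReal_mul (Real.exp_pos _).le]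
      rw [lintegral_const_mul' _ _ ENNReal.ofReal_ne_top]
      gcongr
      refine ih (fun t => a t.succ) (fun t S => g t.succ (Fin.cons z S)) (fun t => ?_)
        (fun t S z' => h01 _ _ _) fun t S S' h => hp _ _ _ fun s hs => ?_
      · exact (hm t.succ).comp ((hc.comp measurable_fst).prodMk measurable_snd)
      · revert hs
        refine Fin.cases ?_ (fun s hs => ?_) s
        · simp
        · simpa using h s (Fin.succ_lt_succ_iff.1 hs)
    refine (lintegral_mono hstep).trans ?_
    rw [lintegral_mul_const' _ _ ENNReal.ofReal_ne_top, Fin.sum_univ_succ, Real.exp_add,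
      ENNReal.ofReal_mul (Real.exp_pos _).le]
    gcongr
    exact lintegral_exp_centered_le D (a 0) f ((hm 0).comp measurable_prodMk_left) (h01 0 _)

/-- Azuma–Hoeffding inequality for the weighted sum of the deviations of a predictable sequence of
`[0, 1]`-valued functions of i.i.d. examples. -/
theorem measureReal_predictable_deviation_le {Z : Type*} [MeasurableSpace Z] (D : Measure Z)
    [IsProbabilityMeasure D] {T : ℕ} (a : Fin T → ℝ) (g : Fin T → (Fin T → Z) → Z → ℝ)
    (hm : ∀ t, Measurable (Function.uncurry (g t)))
    (h01 : ∀ t S z, g t S z ∈ Set.Icc (0 : ℝ) 1)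
    (hp : ∀ t S S', (∀ s < t, S s = S' s) → g t S = g t S')
    {ε V : ℝ} (hε : 0 ≤ ε) (hV : 0 < V) (ha : ∑ t, a t ^ 2 = V) :
    MeasurableSet {S : Fin T → Z | ε ≤ ∑ t, a t * (∫ z, g t S z ∂D - g t S (S t))} ∧
    (Measure.pi fun _ : Fin T => D).real
      {S | ε ≤ ∑ t, a t * (∫ z, g t S z ∂D - g t S (S t))} ≤ Real.exp (-(2 * ε ^ 2 / V)) := by
  have hint : ∀ t, Measurable fun S => ∫ z, g t S z ∂D := fun t =>
    ((hm t).stronglyMeasurable.integral_prod_right).measurable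
  have hdiag : ∀ t, Measurable fun S => g t S (S t) := fun t =>
    (hm t).comp (measurable_id.prodMk (measurable_pi_apply t))
  have hsum : Measurable fun S => ∑ t, a t * (∫ z, g t S z ∂D - g t S (S t)) :=
    Finset.measurable_sum _ fun t _ => ((hint t).sub (hdiag t)).const_mul _
  refine ⟨measurableSet_le measurable_const hsum, ?_⟩
  -- The minimizer of the Chernoff exponent `s ^ 2 * V / 8 - s * ε`.
  set s := 4 * ε / V with hs
  have hs0 : 0 ≤ s := by positivity
  have hmgf := lintegral_exp_predictable_le D T (fun t => s * a t) g hm h01 hp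
  have hmk := mul_meas_ge_le_lintegral (μ := Measure.pi fun _ : Fin T => D)
    (f := fun S => ENNReal.ofReal (Real.exp (∑ t, s * a t * (∫ z, g t S z ∂D - g t S (S t)))))
    (by
      simp only [mul_assoc, ← Finset.mul_sum]
      exact (Real.measurable_exp.comp (hsum.const_mul s)).ennreal_ofReal)
    (ENNReal.ofReal (Real.exp (s * ε)))
  have hsub : {S | ε ≤ ∑ t, a t * (∫ z, g t S z ∂D - g t S (S t))} ⊆
      {S | ENNReal.ofReal (Real.exp (s * ε)) ≤
        ENNReal.ofReal (Real.exp (∑ t, s * a t * (∫ z, g t S z ∂D - g t S (S t))))} := by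
    intro S hS
    refine ENNReal.ofReal_le_ofReal (Real.exp_le_exp.2 ?_)
    simp only [mul_assoc, ← Finset.mul_sum]
    exact mul_le_mul_of_nonneg_left hS hs0
  have hle := (mul_le_mul_right (measure_mono (μ := Measure.pi fun _ : Fin T => D) hsub)
    (ENNReal.ofReal (Real.exp (s * ε)))).trans (hmk.trans hmgf)
  have hreal := ENNReal.toReal_mono ENNReal.ofReal_ne_top hle
  rw [ENNReal.toReal_mul, ENNReal.toReal_ofReal (Real.exp_pos _).le,
    ENNReal.toReal_ofReal (Real.exp_pos _).le, ← Measure.real] at hreal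
  have hexp : ∑ t, (s * a t) ^ 2 / 8 = s * ε + -(2 * ε ^ 2 / V) := by
    simp only [mul_pow, mul_div_assoc, ← Finset.mul_sum, ← Finset.sum_div, ha]
    rw [hs]; field_simp; ring
  rw [hexp, Real.exp_add] at hreal
  exact le_of_mul_le_mul_left hreal (Real.exp_pos _)

/-! ### Signs and mistakes -/

/-- Since `zeroOneLoss` charges `0`, a prediction of `0` counts as a mistake, so loss and update
agree under every convention for `sgn 0`. -/
theorem mul_sgn_nonpos {σ : SignType} {y z : ℝ} (hy : y = 1 ∨ y = -1) :
    y * sgn σ z ≤ 0 ↔ sgn σ z ≠ y := by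
  unfold sgn
  rcases hy with rfl | rfl <;> split_ifs <;> cases σ <;> norm_num

theorem mul_nonpos_of_sgn_ne {σ : SignType} {y z : ℝ} (hy : y = 1 ∨ y = -1)
    (h : sgn σ z ≠ y) : y * z ≤ 0 := by
  unfold sgn at h
  rcases hy with rfl | rfl <;> split_ifs at h <;> first | (exact absurd rfl h) | linarith

theorem mul_sgn_neg {σ : SignType} {y z : ℝ} (h : y * z < 0) : y * sgn σ z ≤ 0 := by
  unfold sgn
  split_ifs with h1 h2
  · nlinarith
  · nlinarith
  · have : z = 0 := by linarith
    simp [this] at h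

variable {N T : ℕ}

/-! ### Predictability and measurability of the iterates -/

theorem weights_zero (σ : SignType) (S : Fin T → Example N) : weights σ S 0 = 0 := rfl

theorem weights_succ (σ : SignType) (S : Fin T → Example N) (t : Fin T) :
    weights σ S t.succ = step σ (weightAt σ S t) (S t) := by
  simp [weights, weightAt]

theorem weights_congr (σ : SignType) {S S' : Fin T → Example N} (k : Fin (T + 1)) :
    (∀ s : Fin T, s.castSucc < k → S s = S' s) → weights σ S k = weights σ S' k := by
  induction k using Fin.induction with
  | zero => intro _; rfl
  | succ t ih =>
    intro h
    rw [weights_succ, weights_succ, weightAt, weightAt,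
      ih fun s hs => h s (hs.trans (Fin.castSucc_lt_succ)), h t Fin.castSucc_lt_succ]

theorem weightAt_congr (σ : SignType) {S S' : Fin T → Example N} (t : Fin T)
    (h : ∀ s < t, S s = S' s) : weightAt σ S t = weightAt σ S' t :=
  weights_congr σ _ fun s hs => h s (Fin.castSucc_lt_castSucc_iff.1 hs)

theorem measurable_sgn (σ : SignType) : Measurable (sgn σ) :=
  Measurable.ite measurableSet_Ioi measurable_const
    (Measurable.ite measurableSet_Iio measurable_const measurable_const)

theorem measurable_predict (σ : SignType) :
    Measurable fun p : EuclideanSpace ℝ (Fin N) × EuclideanSpace ℝ (Fin N) =>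
      predict σ p.1 p.2 :=
  (measurable_sgn σ).comp (measurable_fst.inner measurable_snd)

theorem measurable_step (σ : SignType) :
    Measurable fun p : EuclideanSpace ℝ (Fin N) × Example N => step σ p.1 p.2 := by
  have h1 : Measurable fun p : EuclideanSpace ℝ (Fin N) × Example N => predict σ p.1 p.2.1 :=
    (measurable_predict σ).comp (measurable_fst.prodMk measurable_snd.fst)
  refine Measurable.ite (measurableSet_eq_fun h1 measurable_snd.snd).compl ?_ measurable_fst
  fun_prop

theorem measurable_weights (σ : SignType) (k : Fin (T + 1)) :
    Measurable fun S : Fin T → Example N => weights σ S k := by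
  induction k using Fin.induction with
  | zero => exact measurable_const
  | succ t ih =>
    have h : Measurable fun S : Fin T → Example N => (weights σ S t.castSucc, S t) :=
      ih.prodMk (measurable_pi_apply t)
    have e : (fun S : Fin T → Example N => weights σ S t.succ) =
        (fun p : EuclideanSpace ℝ (Fin N) × Example N => step σ p.1 p.2) ∘
          fun S => (weights σ S t.castSucc, S t) :=
      funext fun S => weights_succ σ S t
    rw [e]
    exact (measurable_step σ).comp h

theorem measurable_zeroOneLoss : Measurable zeroOneLoss :=
  Measurable.ite measurableSet_Iic measurable_const measurable_const

/-- The zero-one loss of the hypothesis with which the algorithm enters round `t`. -/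
noncomputable def roundLoss (σ : SignType) (t : Fin T) (S : Fin T → Example N) (z : Example N) : ℝ :=
  zeroOneLoss (z.2 * predict σ (weightAt σ S t) z.1)

theorem measurable_roundLoss (σ : SignType) (t : Fin T) :
    Measurable (Function.uncurry (roundLoss (N := N) σ t)) := by
  refine measurable_zeroOneLoss.comp (measurable_snd.snd.mul ((measurable_predict σ).comp
    (((measurable_weights σ t.castSucc).comp measurable_fst).prodMk measurable_snd.fst)))

theorem roundLoss_mem_Icc (σ : SignType) (t : Fin T) (S : Fin T → Example N) (z : Example N) :
    roundLoss σ t S z ∈ Set.Icc (0 : ℝ) 1 := by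
  unfold roundLoss zeroOneLoss
  split_ifs <;> simp

/-- Allowing `i < t` lets one fixed hypothesis be tested on all later examples. -/
theorem roundLoss_congr (σ : SignType) {i t : Fin T} (hit : i ≤ t) {S S' : Fin T → Example N}
    (h : ∀ s < t, S s = S' s) : roundLoss σ i S = roundLoss σ i S' := by
  funext z
  rw [roundLoss, roundLoss, weightAt_congr σ i fun s hs => h s (hs.trans_le hit)]

theorem measureReal_margin_neg_le_integral_roundLoss (σ : SignType) (D : Measure (Example N))
    [IsProbabilityMeasure D] (S : Fin T → Example N) (t : Fin T) :
    D.real {z | z.2 * inner ℝ (weightAt σ S t) z.1 < 0} ≤ ∫ z, roundLoss σ t S z ∂D := by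
  have hm : MeasurableSet {z : Example N | z.2 * inner ℝ (weightAt σ S t) z.1 < 0} :=
    measurableSet_lt (by fun_prop) measurable_const
  have hl : Measurable (roundLoss σ t S) := (measurable_roundLoss σ t).comp measurable_prodMk_left
  rw [← integral_indicator_one hm]
  refine integral_mono ((integrable_const (1 : ℝ)).indicator hm) ?_ fun z => ?_
  · refine Integrable.of_mem_Icc 0 1 hl.aemeasurable (ae_of_all _ (roundLoss_mem_Icc σ t S))
  · refine Set.indicator_le' (fun z hz => ?_) (fun z _ => (roundLoss_mem_Icc σ t S z).1) z
    simp [roundLoss, zeroOneLoss, predict, mul_sgn_neg hz]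

theorem sum_roundLoss (σ : SignType) {S : Fin T → Example N}
    (hS : ∀ t, (S t).2 = 1 ∨ (S t).2 = -1) :
    ∑ t, roundLoss σ t S (S t) = (updateRounds σ S).card := by
  have h : ∀ t, roundLoss σ t S (S t) =
      if predict σ (weightAt σ S t) (S t).1 ≠ (S t).2 then 1 else 0 := fun t =>
    if_congr (mul_sgn_nonpos (hS t)) rfl rfl
  simp only [h, updateRounds, Finset.sum_boole]

/-! ### The Perceptron mistake bound -/

theorem sum_succ_sub_castSucc : ∀ {T : ℕ} (f : Fin (T + 1) → ℝ),
    ∑ t : Fin T, (f t.succ - f t.castSucc) = f (Fin.last T) - f 0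
  | 0, f => by simp
  | T + 1, f => by
    have := sum_succ_sub_castSucc fun k : Fin (T + 1) => f k.castSucc
    rw [Fin.sum_univ_castSucc]
    simp only [Fin.succ_castSucc, this, Fin.succ_last, Fin.castSucc_zero]
    ring

theorem inner_weights_last (σ : SignType) (S : Fin T → Example N)
    (u : EuclideanSpace ℝ (Fin N)) :
    inner ℝ u (weights σ S (Fin.last T)) =
      ∑ t ∈ updateRounds σ S, (S t).2 * inner ℝ u (S t).1 := by
  have h := sum_succ_sub_castSucc fun k => inner ℝ u (weights σ S k)
  rw [weights_zero, inner_zero_right, sub_zero] at h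
  rw [← h, updateRounds, Finset.sum_filter]
  refine Finset.sum_congr rfl fun t _ => ?_
  rw [weights_succ, step, ← weightAt]
  split_ifs
  · rw [inner_add_right, real_inner_smul_right]; ring
  · ring

/-- The squared norms telescope, and on an update the cross term `2 y_t (w_t · x_t)` is nonpositive.
-/
theorem norm_weights_last_sq_le (σ : SignType) {S : Fin T → Example N}
    (hS : ∀ t, (S t).2 = 1 ∨ (S t).2 = -1) :
    ‖weights σ S (Fin.last T)‖ ^ 2 ≤ ∑ t ∈ updateRounds σ S, ‖(S t).1‖ ^ 2 := by
  have h := sum_succ_sub_castSucc fun k => ‖weights σ S k‖ ^ 2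
  rw [weights_zero, norm_zero] at h
  have h' : ‖weights σ S (Fin.last T)‖ ^ 2 =
      ∑ t : Fin T, (‖weights σ S t.succ‖ ^ 2 - ‖weights σ S t.castSucc‖ ^ 2) := by
    rw [h]; ring
  rw [h', updateRounds, Finset.sum_filter]
  refine Finset.sum_le_sum fun t _ => ?_
  rw [weights_succ, step, ← weightAt]
  split_ifs with hp
  · have hle := mul_nonpos_of_sgn_ne (hS t) hp
    have hy : (S t).2 ^ 2 = 1 := by rcases hS t with h | h <;> simp [h]
    rw [norm_add_sq_real, real_inner_smul_right, norm_smul, mul_pow, Real.norm_eq_abs, sq_abs, hy]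
    linarith
  · simp

/-- Complete the square: `(√m - a / 2) ^ 2 ≤ a ^ 2 / 4 + b`. -/
theorem le_sq_of_le_mul_sqrt_add {m a b : ℝ} (hm : 0 ≤ m)
    (h : m ≤ a * √m + b) : m ≤ (a / 2 + √(a ^ 2 / 4 + b)) ^ 2 := by
  have hs := Real.sq_sqrt hm
  have h1 : (√m - a / 2) ≤ √(a ^ 2 / 4 + b) := Real.le_sqrt_of_sq_le (by nlinarith)
  calc m = √m ^ 2 := hs.symm
    _ ≤ _ := pow_le_pow_left₀ (Real.sqrt_nonneg m) (by linarith) 2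

theorem card_updateRounds_le (σ : SignType) {S : Fin T → Example N}
    (hS : ∀ t, (S t).2 = 1 ∨ (S t).2 = -1) {ρ : ℝ} (hρ : 0 < ρ)
    {u : EuclideanSpace ℝ (Fin N)} (hu : ‖u‖ ≤ 1) :
    ((updateRounds σ S).card : ℝ) ≤
      (‖hingeLosses S (updateRounds σ S) ρ u‖ / 2 +
        √(‖hingeLosses S (updateRounds σ S) ρ u‖ ^ 2 / 4 +
          √(∑ t ∈ updateRounds σ S, ‖(S t).1‖ ^ 2) / ρ)) ^ 2 := by
  refine le_sq_of_le_mul_sqrt_add (Nat.cast_nonneg _) ?_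
  set I := updateRounds σ S with hI
  set l : Fin T → ℝ := fun t => max (1 - (S t).2 * inner ℝ u (S t).1 / ρ) 0
  have hl : ∑ t ∈ I, l t ≤ ‖hingeLosses S I ρ u‖ * √(I.card : ℝ) := by
    have hn : ‖hingeLosses S I ρ u‖ = √(∑ t ∈ I, l t ^ 2) := by
      rw [EuclideanSpace.norm_eq, ← Finset.sum_coe_sort I]
      simp [hingeLosses, l]
    have := Real.sum_mul_le_sqrt_mul_sqrt I l (fun _ => 1)
    simpa [hn] using this
  have hw : ∑ t ∈ I, (S t).2 * inner ℝ u (S t).1 ≤ √(∑ t ∈ I, ‖(S t).1‖ ^ 2) := by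
    rw [← inner_weights_last]
    refine (real_inner_le_norm _ _).trans ?_
    calc ‖u‖ * ‖weights σ S (Fin.last T)‖ ≤ 1 * ‖weights σ S (Fin.last T)‖ := by gcongr
      _ ≤ _ := by rw [one_mul]; exact Real.le_sqrt_of_sq_le (norm_weights_last_sq_le σ hS)
  calc (I.card : ℝ) = ∑ t ∈ I, (1 : ℝ) := by simp
    _ ≤ ∑ t ∈ I, (l t + (S t).2 * inner ℝ u (S t).1 / ρ) := by
        refine Finset.sum_le_sum fun t _ => ?_
        have := le_max_left (1 - (S t).2 * inner ℝ u (S t).1 / ρ) 0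
        simp only [l]; linarith
    _ = ∑ t ∈ I, l t + (∑ t ∈ I, (S t).2 * inner ℝ u (S t).1) / ρ := by
        rw [Finset.sum_add_distrib, Finset.sum_div]
    _ ≤ _ := by gcongr

theorem card_updateRounds_div_le_iInf (σ : SignType) {S : Fin T → Example N}
    (hS : ∀ t, (S t).2 = 1 ∨ (S t).2 = -1) :
    1 / (T : ℝ) * (updateRounds σ S).card ≤
      ⨅ p : {p : ℝ × EuclideanSpace ℝ (Fin N) // 0 < p.1 ∧ ‖p.2‖ ≤ 1},
        1 / (T : ℝ) * (‖hingeLosses S (updateRounds σ S) p.1.1 p.1.2‖ / 2 +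
          √(‖hingeLosses S (updateRounds σ S) p.1.1 p.1.2‖ ^ 2 / 4 +
            √(∑ t ∈ updateRounds σ S, ‖(S t).1‖ ^ 2) / p.1.1)) ^ 2 := by
  have : Nonempty {p : ℝ × EuclideanSpace ℝ (Fin N) // 0 < p.1 ∧ ‖p.2‖ ≤ 1} :=
    ⟨⟨(1, 0), by simp⟩⟩
  exact le_ciInf fun p => by gcongr; exact card_updateRounds_le σ hS p.2.1 p.2.2

/-! ### Sum of the penalties -/

theorem sum_range_inv_sqrt_le (T : ℕ) : ∑ k ∈ Finset.range T, 1 / √((k : ℝ) + 1) ≤ 2 * √T := by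
  induction T with
  | zero => simp
  | succ n ih =>
    rw [Finset.sum_range_succ]
    push_cast
    have h0 : 0 < √((n : ℝ) + 1) := by positivity
    have h1 := Real.sq_sqrt (show (0 : ℝ) ≤ n by positivity)
    have h2 := Real.sq_sqrt (show (0 : ℝ) ≤ (n : ℝ) + 1 by positivity)
    -- Each term is dominated by an increment of `2√n`.
    have : 1 / √((n : ℝ) + 1) ≤ 2 * √((n : ℝ) + 1) - 2 * √n := by
      rw [div_le_iff₀ h0]
      nlinarith [sq_nonneg (√((n : ℝ) + 1) - √n)]
    linarith

theorem sum_penalty_le (T : ℕ) (A : ℝ) :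
    ∑ i : Fin T, √(A / (2 * ((T : ℝ) - (i : ℕ)))) ≤ √(2 * A) * √T := by
  have h : ∀ i : Fin T, √(A / (2 * ((T : ℝ) - (i : ℕ)))) =
      √(A / 2) * (1 / √(((T - 1 - (i : ℕ) : ℕ) : ℝ) + 1)) := fun i => by
    have hi : ((T - 1 - (i : ℕ) : ℕ) : ℝ) + 1 = (T : ℝ) - (i : ℕ) := by
      rw [eq_sub_iff_add_eq]; exact_mod_cast (by omega)
    have hpos : 0 ≤ (T : ℝ) - (i : ℕ) := sub_nonneg.2 (by exact_mod_cast i.2.le)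
    rw [hi, ← div_div, Real.sqrt_div' _ hpos]; ring
  simp only [h]
  rw [← Finset.mul_sum, Fin.sum_univ_eq_sum_range
    (fun i => 1 / √(((T - 1 - i : ℕ) : ℝ) + 1)) T,
    Finset.sum_range_reflect (fun k => 1 / √((k : ℝ) + 1)) T]
  have h2 : √(2 * A) = 2 * √(A / 2) := by
    rw [show 2 * A = 2 ^ 2 * (A / 2) by ring, Real.sqrt_mul (by norm_num), Real.sqrt_sq (by norm_num)]
  rw [h2]
  nlinarith [sum_range_inv_sqrt_le T, Real.sqrt_nonneg (A / 2)]


/-! ### Deviations of the Perceptron losses -/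

/-- Hoeffding's inequality for the hypothesis entering round `i` on the examples from round `i` on;
`b = 1` and `b = -1` give the two sides. -/
theorem measureReal_tail_deviation_le (σ : SignType) (D : Measure (Example N))
    [IsProbabilityMeasure D] (i : Fin T) {b c : ℝ} (hb : b ^ 2 = 1) (hc : 0 ≤ c) :
    MeasurableSet {S : Fin T → Example N | ((T : ℝ) - (i : ℕ)) * c ≤
      b * ∑ t ∈ Finset.Ici i, (∫ z, roundLoss σ i S z ∂D - roundLoss σ i S (S t))} ∧
    (Measure.pi fun _ : Fin T => D).real {S | ((T : ℝ) - (i : ℕ)) * c ≤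
      b * ∑ t ∈ Finset.Ici i, (∫ z, roundLoss σ i S z ∂D - roundLoss σ i S (S t))} ≤
      Real.exp (-(2 * ((T : ℝ) - (i : ℕ)) * c ^ 2)) := by
  have hn : 0 < (T : ℝ) - (i : ℕ) := sub_pos.2 (by exact_mod_cast i.2)
  have hfilter : (Finset.univ.filter fun t => i ≤ t) = Finset.Ici i := by ext; simp
  have hV : ∑ t, (if i ≤ t then b else 0) ^ 2 = (T : ℝ) - (i : ℕ) := by
    simp only [ite_pow, hb, ne_eq, OfNat.ofNat_ne_zero, not_false_eq_true, zero_pow,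
      Finset.sum_boole, hfilter, Fin.card_Ici]
    rw [Nat.cast_sub i.2.le]
  -- The index `min i t` keeps the sequence predictable before round `i`, where the weight vanishes,
  -- and freezes it at hypothesis `i` afterwards.
  have h := measureReal_predictable_deviation_le D (fun t => if i ≤ t then b else 0)
    (fun t => roundLoss (N := N) σ (min i t)) (fun t => measurable_roundLoss σ _)
    (fun t => roundLoss_mem_Icc σ _)
    (fun t S S' h => roundLoss_congr σ (min_le_right i t) h) (mul_nonneg hn.le hc) hn hV
  have hsum : ∀ S : Fin T → Example N, ∑ t, (if i ≤ t then b else 0) *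
      (∫ z, roundLoss σ (min i t) S z ∂D - roundLoss σ (min i t) S (S t)) =
      b * ∑ t ∈ Finset.Ici i, (∫ z, roundLoss σ i S z ∂D - roundLoss σ i S (S t)) := fun S => by
    rw [Finset.mul_sum, ← hfilter, Finset.sum_filter]
    refine Finset.sum_congr rfl fun t _ => ?_
    split_ifs with hit
    · rw [min_eq_left hit]
    · rw [zero_mul]
  simp only [hsum] at h
  refine ⟨h.1, h.2.trans_eq ?_⟩
  congr 2
  field_simp

/-- Azuma's inequality for the losses of the successive hypotheses on the next example. -/
theorem measureReal_online_deviation_le (σ : SignType) (D : Measure (Example N))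
    [IsProbabilityMeasure D] (hT : 1 ≤ T) {ε : ℝ} (hε : 0 ≤ ε) :
    MeasurableSet {S : Fin T → Example N |
      ε ≤ ∑ t, (∫ z, roundLoss σ t S z ∂D - roundLoss σ t S (S t))} ∧
    (Measure.pi fun _ : Fin T => D).real {S |
      ε ≤ ∑ t, (∫ z, roundLoss σ t S z ∂D - roundLoss σ t S (S t))} ≤
      Real.exp (-(2 * ε ^ 2 / T)) := by
  have h := measureReal_predictable_deviation_le D (fun _ => 1)
    (fun t => roundLoss (N := N) (T := T) σ t) (fun t => measurable_roundLoss σ _)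
    (fun t => roundLoss_mem_Icc σ _)
    (fun t S S' h => roundLoss_congr σ le_rfl h) hε
    (show (0 : ℝ) < T by exact_mod_cast hT) (by simp)
  simpa only [one_mul] using h

/-- If the empirical risks are within their penalties of the true risks, then the minimizer of the
penalized risk has true risk at most `R_j + 2 c_j` for every `j`. -/
theorem integral_roundLoss_minimizer_le (σ : SignType) (D : Measure (Example N))
    {δ : ℝ} {S : Fin T → Example N}
    (hS : ∀ (b : ℝ), b ^ 2 = 1 → ∀ i : Fin T,
      b * ∑ t ∈ Finset.Ici i, (∫ z, roundLoss σ i S z ∂D - roundLoss σ i S (S t)) <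
        ((T : ℝ) - (i : ℕ)) *
          √(Real.log ((T : ℝ) * (T + 1) / δ) / (2 * ((T : ℝ) - (i : ℕ)))))
    {i : Fin T} (hi : IsPenalizedRiskMinimizer σ δ S i) (j : Fin T) :
    ∫ z, roundLoss σ i S z ∂D ≤ ∫ z, roundLoss σ j S z ∂D +
      2 * √(Real.log ((T : ℝ) * (T + 1) / δ) / (2 * ((T : ℝ) - (j : ℕ)))) := by
  have hn : ∀ k : Fin T, 0 < (T : ℝ) - (k : ℕ) := fun k => sub_pos.2 (by exact_mod_cast k.2)
  have hsum : ∀ k : Fin T,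
      ∑ t ∈ Finset.Ici k, (∫ z, roundLoss σ k S z ∂D - roundLoss σ k S (S t)) =
      ((T : ℝ) - (k : ℕ)) * (∫ z, roundLoss σ k S z ∂D - 1 / ((T : ℝ) - (k : ℕ)) *
        ∑ t ∈ Finset.Ici k, roundLoss σ k S (S t)) := fun k => by
    rw [Finset.sum_sub_distrib, Finset.sum_const, Fin.card_Ici, nsmul_eq_mul,
      Nat.cast_sub k.2.le]
    have := (hn k).ne'
    field_simp
  have h1 := hS 1 (by norm_num) i
  have h2 := hS (-1) (by norm_num) j
  rw [hsum, one_mul] at h1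
  rw [hsum, neg_one_mul, ← mul_neg] at h2
  have h1' := lt_of_mul_lt_mul_left h1 (hn i).le
  have h2' := lt_of_mul_lt_mul_left h2 (hn j).le
  have h3 : 1 / ((T : ℝ) - (i : ℕ)) * ∑ t ∈ Finset.Ici i, roundLoss σ i S (S t) +
      √(Real.log ((T : ℝ) * (T + 1) / δ) / (2 * ((T : ℝ) - (i : ℕ)))) ≤
      1 / ((T : ℝ) - (j : ℕ)) * ∑ t ∈ Finset.Ici j, roundLoss σ j S (S t) +
      √(Real.log ((T : ℝ) * (T + 1) / δ) / (2 * ((T : ℝ) - (j : ℕ)))) := hi j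
  linarith

/-! ### Numerical constants and the good event -/

theorem penalty_add_deviation_le (hT : 1 ≤ T) {δ : ℝ} (hδ : 0 < δ) (hδ1 : δ < 1) :
    2 * (√(2 * Real.log ((T : ℝ) * (T + 1) / δ)) * √T) + √(T / 2 * Real.log (2 / δ)) ≤
      T * (6 * √(1 / (T : ℝ) * Real.log (2 * ((T : ℝ) + 1) / δ))) := by
  have hT' : (1 : ℝ) ≤ T := by exact_mod_cast hT
  set B := Real.log (2 * ((T : ℝ) + 1) / δ) with hB
  -- Hence the penalties contribute at most `4 √T √B` and the online deviation at most `√T √B`,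
  -- within the allowed `6 √T √B`.
  have hA : Real.log ((T : ℝ) * (T + 1) / δ) ≤ 2 * B := by
    rw [hB, ← Nat.cast_two, ← Real.log_pow]
    refine Real.log_le_log (by positivity) ?_
    rw [Nat.cast_two, div_pow, div_le_div_iff₀ hδ (by positivity)]
    have h1 : (T : ℝ) * (T + 1) ≤ (2 * (T + 1)) ^ 2 := by nlinarith
    have h2 : δ ^ 2 ≤ δ := by nlinarith
    exact mul_le_mul h1 h2 (by positivity) (by positivity)
  have hC : Real.log (2 / δ) ≤ B :=
    Real.log_le_log (by positivity) (by gcongr; linarith)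
  have hC0 : 0 ≤ Real.log (2 / δ) := Real.log_nonneg (by rw [le_div_iff₀ hδ]; linarith)
  have hTB : (T : ℝ) * √(1 / (T : ℝ) * B) = √T * √B := by
    rw [Real.sqrt_mul (by positivity), Real.sqrt_div zero_le_one, Real.sqrt_one]
    have := Real.mul_self_sqrt (show (0 : ℝ) ≤ T by linarith)
    have h0 : √(T : ℝ) ≠ 0 := (Real.sqrt_pos.2 (by linarith)).ne'
    field_simp
    linear_combination (-√B) * this
  have e1 : √(2 * Real.log ((T : ℝ) * (T + 1) / δ)) ≤ 2 * √B := by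
    rw [show 2 * √B = √(2 ^ 2 * B) by
      rw [Real.sqrt_mul (by norm_num), Real.sqrt_sq (by norm_num)]]
    exact Real.sqrt_le_sqrt (by linarith)
  have e2 : √(T / 2 * Real.log (2 / δ)) ≤ √T * √B := by
    rw [← Real.sqrt_mul (by linarith)]
    exact Real.sqrt_le_sqrt (mul_le_mul (by linarith) hC hC0 (by linarith))
  have e3 := mul_le_mul_of_nonneg_right e1 (Real.sqrt_nonneg (T : ℝ))
  have e4 := mul_nonneg (Real.sqrt_nonneg (T : ℝ)) (Real.sqrt_nonneg B)
  linarith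

/-- The logarithm is at least `1 - 1/4`, so a nontrivial bound forces `T` to be large; the union
bound needs only `3 ≤ T`. -/
theorem three_le_of_lt_one (hT : 1 ≤ T) {δ : ℝ} (hδ : 0 < δ) (hδ1 : δ < 1)
    (h : 6 * √(1 / (T : ℝ) * Real.log (2 * ((T : ℝ) + 1) / δ)) < 1) : 3 ≤ T := by
  have hT' : (1 : ℝ) ≤ T := by exact_mod_cast hT
  have h4 : 4 ≤ 2 * ((T : ℝ) + 1) / δ := by
    rw [le_div_iff₀ hδ]; nlinarith
  have hlog := Real.one_sub_inv_le_log_of_pos (show 0 < 2 * ((T : ℝ) + 1) / δ by linarith)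
  have hinv : (2 * ((T : ℝ) + 1) / δ)⁻¹ ≤ 4⁻¹ := inv_anti₀ (by norm_num) h4
  have hs : √(1 / (T : ℝ) * Real.log (2 * ((T : ℝ) + 1) / δ)) < 1 / 6 := by linarith
  rw [Real.sqrt_lt' (by norm_num), one_div_mul_eq_div, div_lt_iff₀ (by linarith)] at hs
  have : (3 : ℝ) ≤ T := by linarith
  exact_mod_cast this

/-- With probability at least `1 - δ`, all labels are signs, the risks of all hypotheses are
estimated within their penalties, and the risks of the hypotheses are on average close to the
mistake rate. -/
theorem exists_good_samples (hT : 3 ≤ T) (σ : SignType) (D : Measure (Example N))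
    [IsProbabilityMeasure D] (hD : ∀ᵐ z ∂D, z.2 = 1 ∨ z.2 = -1) {δ : ℝ} (hδ : 0 < δ)
    (hδ1 : δ < 1) :
    ∃ G : Set (Fin T → Example N), MeasurableSet G ∧
      1 - δ ≤ (Measure.pi fun _ : Fin T => D).real G ∧ ∀ S ∈ G,
        (∀ t, (S t).2 = 1 ∨ (S t).2 = -1) ∧
        (∀ (b : ℝ), b ^ 2 = 1 → ∀ i : Fin T,
          b * ∑ t ∈ Finset.Ici i, (∫ z, roundLoss σ i S z ∂D - roundLoss σ i S (S t)) <
            ((T : ℝ) - (i : ℕ)) *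
              √(Real.log ((T : ℝ) * (T + 1) / δ) / (2 * ((T : ℝ) - (i : ℕ))))) ∧
        ∑ t, (∫ z, roundLoss σ t S z ∂D - roundLoss σ t S (S t)) <
          √(T / 2 * Real.log (2 / δ)) := by
  have hT' : (3 : ℝ) ≤ T := by exact_mod_cast hT
  set A := Real.log ((T : ℝ) * (T + 1) / δ) with hA
  have hA0 : 0 ≤ A := Real.log_nonneg (by rw [le_div_iff₀ hδ]; nlinarith)
  have hC0 : 0 ≤ Real.log (2 / δ) := Real.log_nonneg (by rw [le_div_iff₀ hδ]; linarith)
  set μ := Measure.pi fun _ : Fin T => D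
  let E : ℝ → Fin T → Set (Fin T → Example N) := fun b i => {S | ((T : ℝ) - (i : ℕ)) *
      √(A / (2 * ((T : ℝ) - (i : ℕ)))) ≤
      b * ∑ t ∈ Finset.Ici i, (∫ z, roundLoss σ i S z ∂D - roundLoss σ i S (S t))}
  have hE : ∀ b : ℝ, b ^ 2 = 1 → ∀ i, MeasurableSet (E b i) ∧
      μ.real (E b i) ≤ δ / (T * (T + 1)) := by
    intro b hb i
    have h := measureReal_tail_deviation_le σ D i hb
      (Real.sqrt_nonneg (A / (2 * ((T : ℝ) - (i : ℕ)))))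
    have hn : 0 < (T : ℝ) - (i : ℕ) := sub_pos.2 (by exact_mod_cast i.2)
    refine ⟨h.1, h.2.trans_eq ?_⟩
    rw [Real.sq_sqrt (by positivity), mul_div_cancel₀ _ (by positivity), hA, Real.exp_neg,
      Real.exp_log (by positivity), inv_div]
  have hF := measureReal_online_deviation_le σ D (by omega : 1 ≤ T)
    (Real.sqrt_nonneg ((T : ℝ) / 2 * Real.log (2 / δ)))
  set F := {S : Fin T → Example N | √(T / 2 * Real.log (2 / δ)) ≤
    ∑ t, (∫ z, roundLoss σ t S z ∂D - roundLoss σ t S (S t))}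
  have hFle : μ.real F ≤ δ / 2 := by
    refine hF.2.trans_eq ?_
    rw [Real.sq_sqrt (by positivity),
      show 2 * ((T : ℝ) / 2 * Real.log (2 / δ)) / T = Real.log (2 / δ) by field_simp,
      Real.exp_neg, Real.exp_log (by positivity), inv_div]
  let P : Set (Fin T → Example N) := {S | ∀ t, (S t).2 = 1 ∨ (S t).2 = -1}
  have hPm : MeasurableSet P := by
    have h1 : MeasurableSet {z : Example N | z.2 = 1 ∨ z.2 = -1} :=
      (measurableSet_eq_fun measurable_snd measurable_const).union
        (measurableSet_eq_fun measurable_snd measurable_const)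
    have h2 : P = ⋂ t, (fun S : Fin T → Example N => S t) ⁻¹' {z | z.2 = 1 ∨ z.2 = -1} := by
      ext S; simp [P]
    rw [h2]
    exact MeasurableSet.iInter fun t => measurable_pi_apply t h1
  have hP : μ.real Pᶜ = 0 := by
    have h : ∀ᵐ S ∂μ, ∀ t, (S t).2 = 1 ∨ (S t).2 = -1 := ae_all_iff.2 fun t =>
      (measurePreserving_eval (fun _ : Fin T => D) t).quasiMeasurePreserving.ae hD
    rw [Measure.real, show μ Pᶜ = 0 from h, ENNReal.toReal_zero]
  have hone : (1 : ℝ) ^ 2 = 1 := by norm_num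
  have hneg : (-1 : ℝ) ^ 2 = 1 := by norm_num
  let U := ⋃ i, (E 1 i ∪ E (-1) i)
  have hUm : MeasurableSet U :=
    MeasurableSet.iUnion fun i => (hE 1 hone i).1.union (hE (-1) hneg i).1
  have hU : μ.real U ≤ δ / 2 := by
    calc μ.real U ≤ ∑ i, μ.real (E 1 i ∪ E (-1) i) := measureReal_iUnion_fintype_le _
      _ ≤ ∑ _i : Fin T, (δ / (T * (T + 1)) + δ / (T * (T + 1))) :=
          Finset.sum_le_sum fun i _ => (measureReal_union_le _ _).trans
            (add_le_add (hE 1 hone i).2 (hE (-1) hneg i).2)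
      _ = 2 * δ / (T + 1) := by
          rw [Finset.sum_const, Finset.card_univ, Fintype.card_fin, nsmul_eq_mul]
          field_simp
          ring
      _ ≤ δ / 2 := by
          -- This is `4 ≤ T + 1`, the only use of `3 ≤ T` that is sharp.
          rw [div_le_div_iff₀ (by linarith) (by norm_num)]
          nlinarith
  have hbad : MeasurableSet (U ∪ F ∪ Pᶜ) := (hUm.union hF.1).union hPm.compl
  refine ⟨(U ∪ F ∪ Pᶜ)ᶜ, hbad.compl, ?_, fun S hS => ?_⟩
  · rw [probReal_compl_eq_one_sub hbad]
    have h1 := measureReal_union_le (μ := μ) (U ∪ F) Pᶜ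
    have h2 := measureReal_union_le (μ := μ) U F
    linarith
  · simp only [Set.mem_compl_iff, Set.mem_union, not_or, not_not, U, Set.mem_iUnion,
      not_exists] at hS
    refine ⟨hS.2, fun b hb i => ?_, not_le.1 hS.1.2⟩
    rcases sq_eq_one_iff.1 hb with rfl | rfl
    · exact not_le.1 (hS.1.1 i).1
    · exact not_le.1 (hS.1.1 i).2

end Perceptron

open Perceptron

theorem corollary4 {N T : ℕ} (hT : 1 ≤ T) (σ : SignType)
    (D : MeasureTheory.Measure (EuclideanSpace ℝ (Fin N) × ℝ))
    [MeasureTheory.IsProbabilityMeasure D]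
    (hD : ∀ᵐ z ∂D, z.2 = 1 ∨ z.2 = -1)
    (δ : ℝ) (hδ : 0 < δ) :
    ∃ G : Set (Fin T → EuclideanSpace ℝ (Fin N) × ℝ),
      MeasurableSet G ∧
      1 - δ ≤ (MeasureTheory.Measure.pi fun _ : Fin T => D).real G ∧
      ∀ S ∈ G, ∀ i : Fin T, Perceptron.IsPenalizedRiskMinimizer σ δ S i →
        D.real {z | z.2 * inner ℝ (Perceptron.weightAt σ S i) z.1 < 0} ≤
          (⨅ p : {p : ℝ × EuclideanSpace ℝ (Fin N) // 0 < p.1 ∧ ‖p.2‖ ≤ 1},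
            1 / (T : ℝ) *
              (‖Perceptron.hingeLosses S (Perceptron.updateRounds σ S) p.1.1 p.1.2‖ / 2 +
                √(‖Perceptron.hingeLosses S (Perceptron.updateRounds σ S) p.1.1 p.1.2‖ ^ 2 / 4 +
                  √(∑ t ∈ Perceptron.updateRounds σ S, ‖(S t).1‖ ^ 2) / p.1.1)) ^ 2) +
          6 * √(1 / (T : ℝ) * Real.log (2 * ((T : ℝ) + 1) / δ)) := by
  by_cases hδ1 : 1 ≤ δ
  · exact ⟨∅, MeasurableSet.empty, by simpa using hδ1, fun S hS => hS.elim⟩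
  rw [not_le] at hδ1
  -- If the deviation term reaches `1` the bound is trivial, since the infimum is nonnegative.
  by_cases hbig : 1 ≤ 6 * √(1 / (T : ℝ) * Real.log (2 * ((T : ℝ) + 1) / δ))
  · refine ⟨Set.univ, MeasurableSet.univ, by simpa using hδ.le, fun S _ i _ => ?_⟩
    exact measureReal_le_one.trans
      (hbig.trans (le_add_of_nonneg_left (Real.iInf_nonneg fun p => by positivity)))
  rw [not_le] at hbig
  obtain ⟨G, hGm, hG, h⟩ :=
    exists_good_samples (three_le_of_lt_one hT hδ hδ1 hbig) σ D hD hδ hδ1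
  refine ⟨G, hGm, hG, fun S hS i hi => ?_⟩
  obtain ⟨hlabel, hdev, honline⟩ := h S hS
  refine (measureReal_margin_neg_le_integral_roundLoss σ D S i).trans ?_
  refine le_trans ?_ (add_le_add_left (card_updateRounds_div_le_iInf σ hlabel) _)
  have hTpos : (0 : ℝ) < T := by exact_mod_cast hT
  -- Summing the comparison over all `j` brings in `∑ R_j`, which the online deviation bounds
  -- through the mistake count.
  have havg := Finset.sum_le_sum fun j (_ : j ∈ Finset.univ) =>
    integral_roundLoss_minimizer_le σ D hdev hi j
  rw [Finset.sum_const, Finset.card_univ, Fintype.card_fin, nsmul_eq_mul,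
    Finset.sum_add_distrib, ← Finset.mul_sum] at havg
  rw [Finset.sum_sub_distrib, sum_roundLoss σ hlabel] at honline
  have hpen := sum_penalty_le T (Real.log ((T : ℝ) * (T + 1) / δ))
  have htot := penalty_add_deviation_le hT hδ hδ1
  refine le_of_mul_le_mul_left ?_ hTpos
  rw [mul_add, one_div_mul_eq_div, mul_div_cancel₀ _ hTpos.ne']
  linarith
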